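/- Let $K$ be a commutative ring which is a reduced $\mathbb{Q}$-algebra, let $n,m\ge 0$ be integers and put $s:=2n+m$; assume $s\ge 1$. Let $A_n$ be the $n$-th Weyl algebra over $K$, i.e. the associative unital $K$-algebra generated by $q_1,\dots,q_n,p_1,\dots,p_n$ subject to the relations $[p_i,q_j]=\delta_{ij}$ and $[p_i,p_j]=[q_i,q_j]=0$, and let $P_m=K[x_{2n+1},\dots,x_{2n+m}]$ be the polynomial algebra in $m$ variables. Write $x_i:=q_i$ and $x_{n+i}:=p_i$ for $1\le i\le n$, so that $x_1,\dots,x_s$ are the canonical generators of $A_n\otimes_K P_m$ and the ordered monomials $x^\alpha:=x_1^{\alpha_1}\cdots x_s^{\alpha_s}$, $\alpha\in\mathbb{N}^s$, form a $K$-basis of it. For $a=\sum_\alpha\lambda_\alpha x^\alpha\in A_n\otimes_K P_m$ put $\deg a:=\max\{\alpha_1+\cdots+\alpha_s \mid \lambda_\alpha\neq 0\}$ (with $\deg 0:=0$), and for a $K$-algebra automorphism $\sigma$ of $A_n\otimes_K P_m$ put $\deg\sigma:=\max\{\deg\sigma(x_i)\mid 1\le i\le s\}$. Then every $K$-algebra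 automorphism $\sigma$ of $A_n\otimes_K P_m$ satisfies $$\deg\sigma^{-1}\le(\deg\sigma)^{s-1}.$$ -/

import Mathlib

open scoped TensorProduct

/-- The defining relations of the `n`-th Weyl algebra, imposed on the free algebra on
`q₁, …, qₙ` (`Sum.inl`) and `p₁, …, pₙ` (`Sum.inr`). -/
inductive WeylAlgebra.Rel (K : Type*) [CommRing K] (n : ℕ) :
    FreeAlgebra K (Fin n ⊕ Fin n) → FreeAlgebra K (Fin n ⊕ Fin n) → Prop
  | qq (i j : Fin n) : WeylAlgebra.Rel K n
      (FreeAlgebra.ι K (Sum.inl i) * FreeAlgebra.ι K (Sum.inl j))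
      (FreeAlgebra.ι K (Sum.inl j) * FreeAlgebra.ι K (Sum.inl i))
  | pp (i j : Fin n) : WeylAlgebra.Rel K n
      (FreeAlgebra.ι K (Sum.inr i) * FreeAlgebra.ι K (Sum.inr j))
      (FreeAlgebra.ι K (Sum.inr j) * FreeAlgebra.ι K (Sum.inr i))
  | pq (i j : Fin n) : WeylAlgebra.Rel K n
      (FreeAlgebra.ι K (Sum.inr i) * FreeAlgebra.ι K (Sum.inl j))
      (FreeAlgebra.ι K (Sum.inl j) * FreeAlgebra.ι K (Sum.inr i) + if i = j then 1 else 0)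

/-- The `n`-th Weyl algebra `Aₙ` over `K`: the `K`-algebra generated by
`q₁, …, qₙ, p₁, …, pₙ` subject to `[pᵢ, qⱼ] = δᵢⱼ`, `[pᵢ, pⱼ] = [qᵢ, qⱼ] = 0`. -/
abbrev WeylAlgebra (K : Type*) [CommRing K] (n : ℕ) : Type _ :=
  RingQuot (WeylAlgebra.Rel K n)

namespace WeylAlgebra

/-- The canonical generators of the Weyl algebra. -/
noncomputable def gen (K : Type*) [CommRing K] (n : ℕ) (i : Fin n ⊕ Fin n) : WeylAlgebra K n :=
  RingQuot.mkAlgHom K (Rel K n) (FreeAlgebra.ι K i)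

/-- The generator `qᵢ`. -/
noncomputable abbrev q (K : Type*) [CommRing K] {n : ℕ} (i : Fin n) : WeylAlgebra K n :=
  gen K n (Sum.inl i)

/-- The generator `pᵢ`. -/
noncomputable abbrev p (K : Type*) [CommRing K] {n : ℕ} (i : Fin n) : WeylAlgebra K n :=
  gen K n (Sum.inr i)

/-- The ordered monomial `q₁^α₁ ⋯ qₙ^αₙ p₁^β₁ ⋯ pₙ^βₙ`. -/
noncomputable def mono (K : Type*) [CommRing K] (n : ℕ) (e : (Fin n →₀ ℕ) × (Fin n →₀ ℕ)) :
    WeylAlgebra K n :=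
  (List.ofFn fun i => q K i ^ e.1 i).prod * (List.ofFn fun i => p K i ^ e.2 i).prod

section Basis

variable {K : Type*} [CommRing K] {n : ℕ}

theorem q_comm (i j : Fin n) : q K i * q K j = q K j * q K i := by
  simpa [gen] using RingQuot.mkAlgHom_rel K (Rel.qq (K := K) i j)

theorem p_comm (i j : Fin n) : p K i * p K j = p K j * p K i := by
  simpa [gen] using RingQuot.mkAlgHom_rel K (Rel.pp (K := K) i j)

theorem p_mul_q (i j : Fin n) :
    p K i * q K j = q K j * p K i + if i = j then 1 else 0 := by
  have h := RingQuot.mkAlgHom_rel K (Rel.pq (K := K) i j)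
  rw [map_mul, map_add, map_mul] at h
  rw [p, q, gen, gen, h]
  split_ifs <;> simp

/-- A pairwise commuting family defines an algebra homomorphism from the polynomial algebra. -/
theorem exists_algHom {W : Type*} [Ring W] [Algebra K W] (x : Fin n → W)
    (hx : ∀ i j, x i * x j = x j * x i) :
    ∃ f : MvPolynomial (Fin n) K →ₐ[K] W, ∀ i, f (MvPolynomial.X i) = x i := by
  have hc : IsMulCommutative (Algebra.adjoin K (Set.range x)) :=
    Algebra.isMulCommutative_adjoin K (by rintro _ ⟨i, rfl⟩ _ ⟨j, rfl⟩; exact hx i j)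
  let _ : CommRing (Algebra.adjoin K (Set.range x)) :=
    { (inferInstance : Ring (Algebra.adjoin K (Set.range x))) with
      mul_comm := hc.is_comm.comm }
  refine ⟨(Algebra.adjoin K (Set.range x)).val.comp
    (MvPolynomial.aeval fun i => ⟨x i, Algebra.subset_adjoin ⟨i, rfl⟩⟩), fun i => ?_⟩
  simp

theorem monomial_eq_prod_ofFn (a : Fin n →₀ ℕ) :
    MvPolynomial.monomial a (1 : K) =
      (List.ofFn fun i => (MvPolynomial.X i : MvPolynomial (Fin n) K) ^ a i).prod := by
  rw [List.prod_ofFn, MvPolynomial.monomial_eq, Finsupp.prod_fintype _ _ (by simp)]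
  simp

theorem algHom_monomial {W : Type*} [Ring W] [Algebra K W] (f : MvPolynomial (Fin n) K →ₐ[K] W)
    (a : Fin n →₀ ℕ) : f (MvPolynomial.monomial a 1) =
      (List.ofFn fun i => f (MvPolynomial.X i) ^ a i).prod := by
  rw [monomial_eq_prod_ofFn, map_list_prod, List.map_ofFn]
  simp [Function.comp_def]

/-- The action on polynomials in `2n` variables `X`, `Y` with `qᵢ` acting as multiplication by
`Xᵢ` and `pᵢ` as multiplication by `Yᵢ` plus `∂/∂Xᵢ`. -/
theorem exists_rep : ∃ r : WeylAlgebra K n →ₐ[K]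
      Module.End K (MvPolynomial (Fin n ⊕ Fin n) K),
    (∀ i h, r (q K i) h = MvPolynomial.X (Sum.inl i) * h) ∧
    (∀ i h, r (p K i) h = MvPolynomial.X (Sum.inr i) * h + MvPolynomial.pderiv (Sum.inl i) h) := by
  let g : FreeAlgebra K (Fin n ⊕ Fin n) →ₐ[K] Module.End K (MvPolynomial (Fin n ⊕ Fin n) K) :=
    FreeAlgebra.lift K (Sum.elim
      (fun i => LinearMap.mulLeft K (MvPolynomial.X (Sum.inl i)))
      (fun i => LinearMap.mulLeft K (MvPolynomial.X (Sum.inr i)) +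
        (MvPolynomial.pderiv (Sum.inl i)).toLinearMap))
  have hg : ∀ ⦃x y⦄, Rel K n x y → g x = g y := by
    intro x y h
    cases h with
    | qq i j =>
      refine LinearMap.ext fun h => ?_
      simp [g]; ring
    | pp i j =>
      have hd : ∀ h : MvPolynomial (Fin n ⊕ Fin n) K,
          MvPolynomial.pderiv (Sum.inl i) (MvPolynomial.pderiv (Sum.inl j) h) =
            MvPolynomial.pderiv (Sum.inl j) (MvPolynomial.pderiv (Sum.inl i) h) := by
        intro h
        have : ⁅MvPolynomial.pderiv (R := K) (Sum.inl i : Fin n ⊕ Fin n),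
            MvPolynomial.pderiv (R := K) (Sum.inl j : Fin n ⊕ Fin n)⁆ = 0 := by
          refine MvPolynomial.derivation_ext fun k => ?_
          classical
          simp only [Derivation.commutator_apply, MvPolynomial.pderiv_X, Pi.single_apply]
          split_ifs <;> simp
        have h2 := DFunLike.congr_fun this h
        rw [Derivation.commutator_apply] at h2
        exact sub_eq_zero.mp (by simpa using h2)
      refine LinearMap.ext fun h => ?_
      simp [g, hd]; ring
    | pq i j =>
      refine LinearMap.ext fun h => ?_
      classical
      by_cases hij : i = j
      · subst hij
        simp [g]; ring
      · have : (Sum.inl j : Fin n ⊕ Fin n) ≠ Sum.inl i := by simpa using Ne.symm hij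
        simp [g, hij, MvPolynomial.pderiv_X_of_ne this]; ring
  refine ⟨RingQuot.liftAlgHom K ⟨g, hg⟩, fun i h => ?_, fun i h => ?_⟩
  · simp [gen, g]
  · simp [gen, g]

theorem linearIndependent_mono : LinearIndependent K (mono K n) := by
  obtain ⟨r, hq, hp⟩ := exists_rep (K := K) (n := n)
  let ev : WeylAlgebra K n →ₗ[K] MvPolynomial (Fin n ⊕ Fin n) K :=
    (LinearMap.applyₗ (1 : MvPolynomial (Fin n ⊕ Fin n) K)).comp r.toLinearMap
  obtain ⟨f, hf⟩ := exists_algHom (K := K) (fun i : Fin n => q K i) q_comm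
  obtain ⟨g, hg⟩ := exists_algHom (K := K) (fun i : Fin n => p K i) p_comm
  have h1 : ∀ u h, r (f u) h = MvPolynomial.rename Sum.inl u * h := by
    intro u
    induction u using MvPolynomial.induction_on with
    | C a => intro h; simp [← MvPolynomial.algebraMap_eq, Algebra.smul_def]
    | add a b ha hb => intro h; simp [ha, hb, add_mul]
    | mul_X a i ha => intro h; simp [ha, hf, hq, mul_assoc]
  have h2 : ∀ v h, r (g v) (MvPolynomial.rename Sum.inr h) =
      MvPolynomial.rename Sum.inr (v * h) := by
    intro v
    induction v using MvPolynomial.induction_on with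
    | C a => intro h; simp [← MvPolynomial.algebraMap_eq, Algebra.smul_def]
    | add a b ha hb => intro h; simp [ha, hb, add_mul]
    | mul_X a i ha =>
      intro h
      have h0 : MvPolynomial.pderiv (Sum.inl i : Fin n ⊕ Fin n)
          (MvPolynomial.rename Sum.inr h : MvPolynomial (Fin n ⊕ Fin n) K) = 0 := by
        induction h using MvPolynomial.induction_on with
        | C a => simp
        | add a b ha hb => simp [ha, hb]
        | mul_X a j ha => simp [ha]
      have h3 := ha (MvPolynomial.X i * h)
      simp only [map_mul, MvPolynomial.rename_X] at h3
      simp [hg, hp, h0, h3, mul_assoc]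
  have hev : ∀ e, ev (mono K n e) = MvPolynomial.monomial
      (e.1.mapDomain Sum.inl + e.2.mapDomain Sum.inr) 1 := by
    intro e
    have : mono K n e = f (MvPolynomial.monomial e.1 1) * g (MvPolynomial.monomial e.2 1) := by
      simp [mono, algHom_monomial, hf, hg]
    have h3 := h2 (MvPolynomial.monomial e.2 1) 1
    rw [map_one (MvPolynomial.rename Sum.inr), mul_one] at h3
    rw [this]
    simp [ev, h1, h3, MvPolynomial.rename_monomial, MvPolynomial.monomial_mul]
  refine LinearIndependent.of_comp ev ?_
  have hinj : Function.Injective (fun e : (Fin n →₀ ℕ) × (Fin n →₀ ℕ) =>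
      (e.1.mapDomain Sum.inl + e.2.mapDomain Sum.inr : Fin n ⊕ Fin n →₀ ℕ)) := by
    rintro ⟨a, b⟩ ⟨c, d⟩ h
    simp only at h
    have hl : ∀ i, a i = c i := fun i => by
      have := DFunLike.congr_fun h (Sum.inl i)
      simpa [Finsupp.mapDomain_apply Sum.inl_injective, Finsupp.mapDomain_of_notMem_range] using this
    have hr : ∀ i, b i = d i := fun i => by
      have := DFunLike.congr_fun h (Sum.inr i)
      simpa [Finsupp.mapDomain_apply Sum.inr_injective, Finsupp.mapDomain_of_notMem_range] using this
    exact Prod.ext (Finsupp.ext hl) (Finsupp.ext hr)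
  have := (MvPolynomial.basisMonomials (Fin n ⊕ Fin n) K).linearIndependent.comp _ hinj
  have he : (ev ∘ mono K n) = (MvPolynomial.basisMonomials (Fin n ⊕ Fin n) K) ∘
      (fun e => e.1.mapDomain Sum.inl + e.2.mapDomain Sum.inr) := by
    funext e
    simp [hev]
  rw [he]
  exact this

theorem span_mono : ⊤ ≤ Submodule.span K (Set.range (mono K n)) := by
  obtain ⟨f, hf⟩ := exists_algHom (K := K) (fun i : Fin n => q K i) q_comm
  obtain ⟨g, hg⟩ := exists_algHom (K := K) (fun i : Fin n => p K i) p_comm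
  set S := Submodule.span K (Set.range (mono K n)) with hS
  have hmono : ∀ e, mono K n e =
      f (MvPolynomial.monomial e.1 1) * g (MvPolynomial.monomial e.2 1) := by
    intro e; simp [mono, algHom_monomial, hf, hg]
  have hfg : ∀ u v, f u * g v ∈ S := by
    intro u v
    induction u using MvPolynomial.induction_on' with
    | add a b ha hb => rw [map_add, add_mul]; exact S.add_mem ha hb
    | monomial a c =>
      induction v using MvPolynomial.induction_on' with
      | add x y hx hy => rw [map_add, mul_add]; exact S.add_mem hx hy
      | monomial b d =>
        have h1 : MvPolynomial.monomial a c = c • MvPolynomial.monomial a (1 : K) := by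
          simp [MvPolynomial.smul_monomial]
        have h2 : MvPolynomial.monomial b d = d • MvPolynomial.monomial b (1 : K) := by
          simp [MvPolynomial.smul_monomial]
        rw [h1, h2, map_smul, map_smul, smul_mul_smul_comm]
        exact S.smul_mem _ (Submodule.subset_span ⟨(a, b), hmono _⟩)
  have hpf : ∀ i u, p K i * f u = f u * p K i + f (MvPolynomial.pderiv i u) := by
    intro i u
    induction u using MvPolynomial.induction_on with
    | C a =>
      rw [← MvPolynomial.algebraMap_eq, AlgHom.commutes, ← Algebra.commutes]
      simp
    | add a b ha hb => simp only [map_add, mul_add, add_mul, ha, hb]; abel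
    | mul_X a j ha =>
      classical
      rw [map_mul, ← mul_assoc, ha, hf, add_mul, mul_assoc, p_mul_q, MvPolynomial.pderiv_mul,
        MvPolynomial.pderiv_X, map_add, map_mul, hf, Pi.single_apply]
      by_cases hij : i = j
      · subst hij
        simp [mul_add, mul_assoc]; abel
      · simp [hij, Ne.symm hij, mul_assoc]
  have hgen : ∀ k, ∀ s ∈ S, gen K n k * s ∈ S := by
    intro k s hs
    refine Submodule.span_induction ?_ ?_ ?_ ?_ hs
    · rintro _ ⟨e, rfl⟩
      rw [hmono]
      cases k with
      | inl i =>
        change q K i * _ ∈ S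
        rw [← hf i, ← mul_assoc, ← map_mul]
        exact hfg _ _
      | inr i =>
        change p K i * _ ∈ S
        rw [← mul_assoc, hpf, add_mul, mul_assoc, ← hg i, ← map_mul]
        exact S.add_mem (hfg _ _) (hfg _ _)
    · simp
    · intro x y _ _ hx hy; rw [mul_add]; exact S.add_mem hx hy
    · intro c x _ hx; rw [mul_smul_comm]; exact S.smul_mem c hx
  have hall : ∀ w : FreeAlgebra K (Fin n ⊕ Fin n), ∀ s ∈ S,
      RingQuot.mkAlgHom K (Rel K n) w * s ∈ S := by
    intro w
    induction w using FreeAlgebra.induction with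
    | grade0 c => intro s hs; rw [AlgHom.commutes, ← Algebra.smul_def]; exact S.smul_mem c hs
    | grade1 k => exact hgen k
    | mul a b ha hb => intro s hs; rw [map_mul, mul_assoc]; exact ha _ (hb s hs)
    | add a b ha hb => intro s hs; rw [map_add, add_mul]; exact S.add_mem (ha s hs) (hb s hs)
  intro a _
  obtain ⟨w, rfl⟩ := RingQuot.mkAlgHom_surjective K (Rel K n) a
  have h1 : (1 : WeylAlgebra K n) ∈ S := by simpa using hfg 1 1
  simpa using hall w 1 h1

end Basis

/-- The `K`-basis of the Weyl algebra formed by the ordered monomials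
`q₁^α₁ ⋯ qₙ^αₙ p₁^β₁ ⋯ pₙ^βₙ`. -/
noncomputable def basis (K : Type*) [CommRing K] (n : ℕ) :
    Module.Basis ((Fin n →₀ ℕ) × (Fin n →₀ ℕ)) K (WeylAlgebra K n) :=
  Module.Basis.mk linearIndependent_mono span_mono

end WeylAlgebra

/-- The algebra `Aₙ ⊗ Pₘ` over `K`, where `Aₙ` is the Weyl algebra and `Pₘ` is the polynomial
algebra in `m` variables. -/
abbrev WeylPoly (K : Type*) [CommRing K] (n m : ℕ) : Type _ :=
  WeylAlgebra K n ⊗[K] MvPolynomial (Fin m) K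

namespace WeylPoly

/-- The canonical generators `x₁, …, xₛ` of `Aₙ ⊗ Pₘ`, `s = 2n + m`: the elements `qᵢ ⊗ 1`,
`pᵢ ⊗ 1` and `1 ⊗ Xⱼ`. -/
noncomputable def gen (K : Type*) [CommRing K] (n m : ℕ) :
    (Fin n ⊕ Fin n) ⊕ Fin m → WeylPoly K n m :=
  Sum.elim (fun i => WeylAlgebra.gen K n i ⊗ₜ[K] 1) (fun j => 1 ⊗ₜ[K] MvPolynomial.X j)

/-- The `K`-basis of `Aₙ ⊗ Pₘ` formed by the ordered monomials `x^α` in the canonical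
generators; the multi-exponent is the triple of its `q`-, `p`- and polynomial parts. -/
noncomputable def basis (K : Type*) [CommRing K] (n m : ℕ) :
    Module.Basis (((Fin n →₀ ℕ) × (Fin n →₀ ℕ)) × (Fin m →₀ ℕ)) K (WeylPoly K n m) :=
  (WeylAlgebra.basis K n).tensorProduct (MvPolynomial.basisMonomials (Fin m) K)

/-- The total degree `|α| = α₁ + ⋯ + αₛ` of a multi-exponent. -/
def expDegree {n m : ℕ} (α : ((Fin n →₀ ℕ) × (Fin n →₀ ℕ)) × (Fin m →₀ ℕ)) : ℕ :=
  ∑ i, α.1.1 i + ∑ i, α.1.2 i + ∑ j, α.2 j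

/-- The degree of `a = ∑ λ_α x^α`: the maximum of `|α|` over all `α` with `λ_α ≠ 0`
(and `0` for `a = 0`). -/
noncomputable def degree {K : Type*} [CommRing K] {n m : ℕ} (a : WeylPoly K n m) : ℕ :=
  ((basis K n m).repr a).support.sup expDegree

/-- The degree of an automorphism `σ`: the maximum of the degrees of the `σ(xᵢ)`. -/
noncomputable def autDegree {K : Type*} [CommRing K] {n m : ℕ}
    (σ : WeylPoly K n m ≃ₐ[K] WeylPoly K n m) : ℕ :=
  Finset.univ.sup fun i => degree (σ (gen K n m i))

end WeylPoly

/-! Sending a PBW basis to the commutative monomials identifies the algebra `W` with a polynomial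
ring as a module, and the product of `W` differs from the commutative product only in lower degree.
Over a domain, leading exponents in the degree-lexicographic order therefore add under
multiplication. Let `a = σ⁻¹(xⱼ)` have degree `e` and leading exponent `lam`, and let `d = deg σ`.
The products `b μ * a ^ k` with `lam ≰ μ` have distinct leading exponents `μ + k • lam`, hence are
linearly independent, while `σ (b μ * a ^ k) = σ (b μ) * xⱼ ^ k` has degree at most `d|μ| + k`
instead of the `d(|μ| + k e)` that the degree of `b μ * a ^ k` would suggest. Counting these images
among all monomials of bounded degree gives `d * e ≤ d ^ s`. A reduced ring embeds into a product
of domains, and degrees can be tested on the factors. -/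

open MvPolynomial MonomialOrder

section WordSpan

variable (K : Type*) {ι W : Type*} [CommRing K] [Ring W] [Algebra K W] (x : ι → W)

/-- The span of the products of fewer than `k` members of the family `x`: the piece of degree
`k - 1` of the standard filtration. The strict bound makes `wordSpan K x 0` trivial, so that the
error terms of words of any length, the empty one included, are treated alike. -/
def wordSpan (k : ℕ) : Submodule K W :=
  Submodule.span K {w | ∃ l : List ι, l.length < k ∧ (l.map x).prod = w}

variable {K x}

theorem prod_mem_wordSpan {l : List ι} {k : ℕ} (h : l.length < k) :
    (l.map x).prod ∈ wordSpan K x k :=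
  Submodule.subset_span ⟨l, h, rfl⟩

theorem gen_mem_wordSpan (i : ι) : x i ∈ wordSpan K x 2 := by
  simpa using prod_mem_wordSpan (K := K) (x := x) (l := [i]) (k := 2) (by simp)

theorem algebraMap_mem_wordSpan (c : K) {k : ℕ} (hk : 0 < k) :
    algebraMap K W c ∈ wordSpan K x k := by
  rw [Algebra.algebraMap_eq_smul_one]
  exact Submodule.smul_mem _ _ (prod_mem_wordSpan (l := []) hk)

theorem wordSpan_mono {k l : ℕ} (h : k ≤ l) : wordSpan K x k ≤ wordSpan K x l :=
  Submodule.span_mono fun _ ⟨t, ht, e⟩ => ⟨t, ht.trans_le h, e⟩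

theorem mul_mem_wordSpan {j k : ℕ} {u v : W} (hu : u ∈ wordSpan K x (j + 1))
    (hv : v ∈ wordSpan K x k) : u * v ∈ wordSpan K x (j + k) := by
  suffices wordSpan K x (j + 1) * wordSpan K x k ≤ wordSpan K x (j + k) from
    this (Submodule.mul_mem_mul hu hv)
  rw [wordSpan, wordSpan, Submodule.span_mul_span, Submodule.span_le]
  rintro _ ⟨_, ⟨l, hl, rfl⟩, _, ⟨l', hl', rfl⟩, rfl⟩
  change (l.map x).prod * (l'.map x).prod ∈ _
  rw [← List.prod_append, ← List.map_append]
  exact prod_mem_wordSpan (by rw [List.length_append]; omega)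

theorem prod_sub_prod_mem_wordSpan_of_perm
    (hx : ∀ i j, x i * x j - x j * x i ∈ wordSpan K x 2) {l l' : List ι} (h : l.Perm l') :
    (l.map x).prod - (l'.map x).prod ∈ wordSpan K x l.length := by
  induction h with
  | nil => simp
  | cons i _ ih =>
    rw [List.map_cons, List.map_cons, List.prod_cons, List.prod_cons, ← mul_sub, List.length_cons,
      add_comm]
    exact mul_mem_wordSpan (gen_mem_wordSpan i) ih
  | swap i j l =>
    simp only [List.map_cons, List.prod_cons, ← mul_assoc, ← sub_mul, List.length_cons]
    rw [add_comm]
    exact mul_mem_wordSpan (hx j i) (prod_mem_wordSpan l.length.lt_succ_self)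
  | trans h₁ _ ih₁ ih₂ =>
    rw [← sub_add_sub_cancel]
    exact add_mem ih₁ (h₁.length_eq ▸ ih₂)

theorem one_tmul_mem_wordSpan (L : Type*) [CommRing L] [Algebra K L] {k : ℕ} {u : W}
    (hu : u ∈ wordSpan K x k) :
    (1 : L) ⊗ₜ[K] u ∈ wordSpan L (fun i => (1 : L) ⊗ₜ[K] x i) k := by
  let includeRight : W →ₐ[K] L ⊗[K] W := Algebra.TensorProduct.includeRight
  suffices wordSpan K x k ≤ ((wordSpan L (fun i => (1 : L) ⊗ₜ[K] x i) k).restrictScalars K).comap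
      includeRight.toLinearMap from this hu
  refine Submodule.span_le.mpr ?_
  rintro _ ⟨l, hl, rfl⟩
  change includeRight (l.map x).prod ∈ wordSpan L _ k
  rw [map_list_prod, List.map_map]
  exact prod_mem_wordSpan hl

end WordSpan

section LowDegree

variable (K ι : Type*) [CommRing K]

/-- The polynomials of total degree less than `k`; for `k = 0` only the zero polynomial, which
`totalDegree` does not distinguish from the constants. -/
noncomputable def lowDegree (k : ℕ) : Submodule K (MvPolynomial ι K) :=
  restrictSupport K {γ | γ.degree < k}

variable {K ι}

theorem mem_lowDegree {k : ℕ} {p : MvPolynomial ι K} :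
    p ∈ lowDegree K ι k ↔ ∀ γ ∈ p.support, γ.degree < k :=
  mem_restrictSupport_iff K

theorem lowDegree_mono {k l : ℕ} (h : k ≤ l) : lowDegree K ι k ≤ lowDegree K ι l :=
  restrictSupport_mono K fun _ hγ => lt_of_lt_of_le hγ h

theorem monomial_mem_lowDegree {k : ℕ} {α : ι →₀ ℕ} (h : α.degree < k) (c : K) :
    monomial α c ∈ lowDegree K ι k :=
  (monomial_mem_restrictSupport K).mpr (Or.inl h)

theorem mem_lowDegree_of_totalDegree_lt {k : ℕ} {p : MvPolynomial ι K} (h : p.totalDegree < k) :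
    p ∈ lowDegree K ι k :=
  mem_lowDegree.mpr fun _ hγ => (le_totalDegree hγ).trans_lt h

theorem totalDegree_le_of_mem_lowDegree {k : ℕ} {p : MvPolynomial ι K}
    (hp : p ∈ lowDegree K ι k) : p.totalDegree ≤ k :=
  Finset.sup_le fun γ hγ => (mem_lowDegree.mp hp γ hγ).le

theorem eq_zero_of_mem_lowDegree_totalDegree {p : MvPolynomial ι K}
    (hp : p ∈ lowDegree K ι p.totalDegree) : p = 0 := by
  by_contra hp0
  obtain ⟨γ, hγ, hdeg⟩ := p.support.exists_mem_eq_sup (support_nonempty.mpr hp0) Finsupp.degree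
  exact (mem_lowDegree.mp hp γ hγ).ne hdeg.symm

theorem degLex_degree_add_of_mem_lowDegree [LinearOrder ι] [WellFoundedGT ι]
    {p r : MvPolynomial ι K} (hr : r ∈ lowDegree K ι p.totalDegree) :
    degLex.degree (p + r) = degLex.degree p := by
  obtain rfl | hr0 := eq_or_ne r 0
  · rw [add_zero]
  refine degLex.degree_add_of_lt (degLex_lt_iff.mpr (Finsupp.DegLex.lt_iff.mpr (Or.inl ?_)))
  change (degLex.degree r).degree < (degLex.degree p).degree
  rw [degree_degLexDegree (f := p)]
  exact mem_lowDegree.mp hr _ (degLex.degree_mem_support hr0)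

end LowDegree

section FullSymbol

variable {K ι W : Type*} [CommRing K] [Ring W] [Algebra K W]

/-- The full symbol of an element of `W` with respect to a basis `b` indexed by multi-exponents:
the commutative polynomial with the same coefficients. It is linear but not multiplicative, and its
total degree is the degree of the element. -/
noncomputable def fullSymbol (b : Module.Basis (ι →₀ ℕ) K W) : W ≃ₗ[K] MvPolynomial ι K :=
  b.equiv (basisMonomials ι K) (Equiv.refl _)

variable {b : Module.Basis (ι →₀ ℕ) K W}

theorem fullSymbol_basis (α : ι →₀ ℕ) : fullSymbol b (b α) = monomial α 1 := by
  simp [fullSymbol]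

theorem coeff_fullSymbol (u : W) (α : ι →₀ ℕ) : (fullSymbol b u).coeff α = b.repr u α := rfl

theorem sum_coeff_fullSymbol_smul (u : W) :
    ∑ α ∈ (fullSymbol b u).support, (fullSymbol b u).coeff α • b α = u := by
  refine (fullSymbol b).injective ?_
  rw [map_sum]
  conv_rhs => rw [as_sum (fullSymbol b u)]
  refine Finset.sum_congr rfl fun α _ => ?_
  rw [map_smul, fullSymbol_basis, smul_monomial, smul_eq_mul, mul_one]

theorem fullSymbol_baseChange_one_tmul (L : Type*) [CommRing L] [Algebra K L] (u : W) :
    fullSymbol (b.baseChange L) (1 ⊗ₜ[K] u) = map (algebraMap K L) (fullSymbol b u) := by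
  ext α
  rw [coeff_fullSymbol, Module.Basis.baseChange_repr_tmul, coeff_map, coeff_fullSymbol,
    Algebra.smul_def, mul_one]

end FullSymbol

/-- The family of generators `x` has `b` as a Poincaré–Birkhoff–Witt basis: the commutators of the
generators have degree at most one, and `b α` is the product of the generators with multiplicities
`α`. The order of the factors of `b α` is left open, and may vary with `α`, because reordering
changes a word only in lower degree. -/
structure IsPBWBasis {K ι W : Type*} [CommRing K] [Ring W] [Algebra K W]
    (x : ι → W) (b : Module.Basis (ι →₀ ℕ) K W) : Prop where
  commutator_mem : ∀ i j, x i * x j - x j * x i ∈ wordSpan K x 2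
  exists_word : ∀ α, ∃ l : List ι, (l : Multiset ι) = Finsupp.toMultiset α ∧ b α = (l.map x).prod

theorem length_eq_degree_of_coe_eq {ι : Type*} {l : List ι} {α : ι →₀ ℕ}
    (h : (l : Multiset ι) = Finsupp.toMultiset α) : l.length = α.degree := by
  rw [← Multiset.coe_card, h, Finsupp.card_toMultiset]
  rfl

namespace IsPBWBasis

section CommRing

variable {K ι W : Type*} [CommRing K] [Ring W] [Algebra K W] {x : ι → W}
  {b : Module.Basis (ι →₀ ℕ) K W}

theorem basis_zero (h : IsPBWBasis x b) : b 0 = 1 := by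
  obtain ⟨l, hl, hb⟩ := h.exists_word 0
  have hnil : l = [] := by simpa using hl
  simpa [hnil] using hb

theorem basis_single (h : IsPBWBasis x b) (i : ι) : b (Finsupp.single i 1) = x i := by
  obtain ⟨l, hl, hb⟩ := h.exists_word (Finsupp.single i 1)
  have hsingle : l = [i] := by simpa using hl
  simpa [hsingle] using hb

theorem fullSymbol_algebraMap (h : IsPBWBasis x b) (c : K) :
    fullSymbol b (algebraMap K W c) = C c := by
  rw [Algebra.algebraMap_eq_smul_one, map_smul, ← h.basis_zero, fullSymbol_basis, smul_monomial,
    smul_eq_mul, mul_one, C_apply]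

theorem fullSymbol_one (h : IsPBWBasis x b) : fullSymbol b 1 = 1 := by
  rw [← map_one (algebraMap K W), h.fullSymbol_algebraMap, C_1]

theorem fullSymbol_gen (h : IsPBWBasis x b) (i : ι) : fullSymbol b (x i) = X i := by
  rw [← h.basis_single, fullSymbol_basis, X]

theorem fullSymbol_mem_lowDegree (h : IsPBWBasis x b) {k : ℕ} {u : W}
    (hu : u ∈ wordSpan K x k) : fullSymbol b u ∈ lowDegree K ι k := by
  suffices wordSpan K x k ≤ (lowDegree K ι k).comap (fullSymbol b).toLinearMap from this hu
  clear hu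
  induction k with
  | zero => exact Submodule.span_le.mpr fun _ ⟨_, hl, _⟩ => absurd hl (Nat.not_lt_zero _)
  | succ k ih =>
    classical
    refine Submodule.span_le.mpr ?_
    rintro _ ⟨l, hl, rfl⟩
    obtain ⟨α, hα⟩ := (Multiset.toFinsupp.symm).surjective (l : Multiset ι)
    obtain ⟨l', hl', hb⟩ := h.exists_word α
    have hperm : l.Perm l' := Multiset.coe_eq_coe.mp (hα.symm.trans hl'.symm)
    have hdiff := ih (wordSpan_mono (Nat.lt_succ_iff.mp hl)
      (prod_sub_prod_mem_wordSpan_of_perm h.commutator_mem hperm))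
    have hsorted : fullSymbol b (l'.map x).prod ∈ lowDegree K ι (k + 1) := by
      rw [← hb, fullSymbol_basis]
      exact monomial_mem_lowDegree (by rwa [← length_eq_degree_of_coe_eq hl', ← hperm.length_eq]) 1
    rw [← sub_add_cancel (l.map x).prod (l'.map x).prod]
    exact add_mem (lowDegree_mono k.le_succ hdiff) hsorted

theorem fullSymbol_basis_mul_basis_sub_mem (h : IsPBWBasis x b) (α β : ι →₀ ℕ) :
    fullSymbol b (b α * b β) - monomial (α + β) 1 ∈ lowDegree K ι (α.degree + β.degree) := by
  obtain ⟨l, hl, hb⟩ := h.exists_word α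
  obtain ⟨l', hl', hb'⟩ := h.exists_word β
  obtain ⟨l'', hl'', hb''⟩ := h.exists_word (α + β)
  have hperm : (l ++ l').Perm l'' := Multiset.coe_eq_coe.mp (by
    rw [hl'', map_add, ← hl, ← hl', Multiset.coe_add])
  rw [← fullSymbol_basis (b := b), ← map_sub, hb, hb', hb'', ← List.prod_append,
    ← List.map_append, ← length_eq_degree_of_coe_eq hl, ← length_eq_degree_of_coe_eq hl',
    ← List.length_append]
  exact h.fullSymbol_mem_lowDegree (prod_sub_prod_mem_wordSpan_of_perm h.commutator_mem hperm)

theorem fullSymbol_mul_sub_mem (h : IsPBWBasis x b) (u v : W) :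
    fullSymbol b (u * v) - fullSymbol b u * fullSymbol b v ∈
      lowDegree K ι ((fullSymbol b u).totalDegree + (fullSymbol b v).totalDegree) := by
  set p := fullSymbol b u with hp
  set q := fullSymbol b v with hq
  have hexpand : fullSymbol b (u * v) - p * q =
      ∑ α ∈ p.support, ∑ β ∈ q.support, (p.coeff α * q.coeff β) •
        (fullSymbol b (b α * b β) - monomial (α + β) 1) := by
    conv_lhs => rw [← sum_coeff_fullSymbol_smul (b := b) u, ← sum_coeff_fullSymbol_smul (b := b) v,
      as_sum p, as_sum q, ← hp, ← hq]
    simp only [Finset.sum_mul_sum, smul_mul_smul_comm, map_sum, map_smul, ← Finset.sum_sub_distrib,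
      smul_sub, monomial_mul, smul_monomial, smul_eq_mul, mul_one]
  rw [hexpand]
  exact Submodule.sum_mem _ fun α hα => Submodule.sum_mem _ fun β hβ => Submodule.smul_mem _ _
    (lowDegree_mono (add_le_add (le_totalDegree hα) (le_totalDegree hβ))
      (h.fullSymbol_basis_mul_basis_sub_mem α β))

theorem totalDegree_fullSymbol_mul_le (h : IsPBWBasis x b) (u v : W) :
    (fullSymbol b (u * v)).totalDegree ≤
      (fullSymbol b u).totalDegree + (fullSymbol b v).totalDegree := by
  rw [← sub_add_cancel (fullSymbol b (u * v)) (fullSymbol b u * fullSymbol b v)]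
  exact (totalDegree_add _ _).trans (max_le
    (totalDegree_le_of_mem_lowDegree (h.fullSymbol_mul_sub_mem u v)) (totalDegree_mul _ _))

theorem totalDegree_fullSymbol_pow_le (h : IsPBWBasis x b) (u : W) (k : ℕ) :
    (fullSymbol b (u ^ k)).totalDegree ≤ k * (fullSymbol b u).totalDegree := by
  induction k with
  | zero => simp [h.fullSymbol_one]
  | succ k ih =>
    rw [pow_succ, add_one_mul]
    exact (h.totalDegree_fullSymbol_mul_le _ _).trans (Nat.add_le_add_right ih _)

theorem totalDegree_fullSymbol_map_basis_le (h : IsPBWBasis x b) (σ : W →ₐ[K] W) {d : ℕ}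
    (hd : ∀ i, (fullSymbol b (σ (x i))).totalDegree ≤ d) (α : ι →₀ ℕ) :
    (fullSymbol b (σ (b α))).totalDegree ≤ d * α.degree := by
  obtain ⟨l, hl, hb⟩ := h.exists_word α
  rw [hb, ← length_eq_degree_of_coe_eq hl]
  clear hl hb
  induction l with
  | nil => simp [h.fullSymbol_one]
  | cons i l ih =>
    rw [List.map_cons, List.prod_cons, map_mul, List.length_cons, Nat.mul_succ, add_comm]
    exact (h.totalDegree_fullSymbol_mul_le _ _).trans (add_le_add (hd i) ih)

theorem baseChange (h : IsPBWBasis x b) (L : Type*) [CommRing L] [Algebra K L] :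
    IsPBWBasis (fun i => (1 : L) ⊗ₜ[K] x i) (b.baseChange L) where
  commutator_mem i j := by
    simpa only [Algebra.TensorProduct.tmul_mul_tmul, mul_one, TensorProduct.tmul_sub] using
      one_tmul_mem_wordSpan L (h.commutator_mem i j)
  exists_word α := by
    obtain ⟨l, hl, hb⟩ := h.exists_word α
    refine ⟨l, hl, ?_⟩
    rw [Module.Basis.baseChange_apply, hb, ← Algebra.TensorProduct.includeRight_apply,
      map_list_prod, List.map_map]
    rfl

theorem totalDegree_fullSymbol_map_gen_pos [Nontrivial K] (h : IsPBWBasis x b) (σ : W ≃ₐ[K] W)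
    (i : ι) : 0 < (fullSymbol b (σ (x i))).totalDegree := by
  by_contra! hdeg
  obtain ⟨c, hc⟩ : ∃ c, fullSymbol b (σ (x i)) = C c :=
    ⟨_, totalDegree_eq_zero_iff_eq_C.mp (Nat.le_zero.mp hdeg)⟩
  rw [← h.fullSymbol_algebraMap, (fullSymbol b).injective.eq_iff, ← σ.commutes,
    σ.injective.eq_iff] at hc
  have hX : (X i : MvPolynomial ι K) = C c := by
    rw [← h.fullSymbol_gen, hc, h.fullSymbol_algebraMap]
  simpa using congrArg totalDegree hX

end CommRing

end IsPBWBasis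

section Exponents

variable {ι : Type*} {lam : ι →₀ ℕ}

theorem le_of_add_nsmul_eq_add_nsmul {μ μ' : ι →₀ ℕ} {i i' : ℕ} (hμ : ¬ lam ≤ μ)
    (h : μ + i • lam = μ' + i' • lam) : i' ≤ i := by
  by_contra! hlt
  obtain ⟨k, rfl⟩ := Nat.exists_eq_add_of_lt hlt
  have hμ' : μ = μ' + k • lam + lam := by
    refine add_right_cancel (b := i • lam) ?_
    rw [h, add_smul, add_smul, one_smul]
    abel
  exact hμ (hμ' ▸ le_add_self)

theorem injective_add_nsmul (lam : ι →₀ ℕ) :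
    Function.Injective fun p : {μ // ¬ lam ≤ μ} × ℕ => (p.1 : ι →₀ ℕ) + p.2 • lam := by
  rintro ⟨⟨μ, hμ⟩, i⟩ ⟨⟨μ', hμ'⟩, i'⟩ (h : μ + i • lam = μ' + i' • lam)
  obtain rfl : i = i' := le_antisymm (le_of_add_nsmul_eq_add_nsmul hμ' h.symm)
    (le_of_add_nsmul_eq_add_nsmul hμ h)
  obtain rfl : μ = μ' := add_right_cancel h
  rfl

theorem surjective_add_nsmul (h : lam ≠ 0) :
    Function.Surjective fun p : {μ // ¬ lam ≤ μ} × ℕ => (p.1 : ι →₀ ℕ) + p.2 • lam := by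
  intro ν
  induction hn : ν.degree using Nat.strong_induction_on generalizing ν with
  | _ n ih =>
    by_cases hle : lam ≤ ν
    · have hcancel : ν - lam + lam = ν := tsub_add_cancel_of_le hle
      have hdeg : (ν - lam).degree + lam.degree = n := by rw [← map_add, hcancel, hn]
      have hpos : lam.degree ≠ 0 := (Finsupp.degree_eq_zero_iff lam).not.mpr h
      obtain ⟨⟨μ, k⟩, hk⟩ := ih (ν - lam).degree (by omega) (ν - lam) rfl
      refine ⟨(μ, k + 1), ?_⟩
      change (μ : ι →₀ ℕ) + (k + 1) • lam = ν
      rw [add_smul, one_smul, ← add_assoc, ← hcancel, ← hk]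
    · exact ⟨(⟨ν, hle⟩, 0), by simp⟩

/-- Division with remainder of multi-exponents by `lam`, with the quotients spread out to the
multiples of `q` in order to absorb an additional residue modulo `q`. -/
theorem exists_equiv_not_le_prod (h : lam ≠ 0) (q : ℕ) [NeZero q] :
    ∃ φ : (ι →₀ ℕ) × Fin q ≃ {μ // ¬ lam ≤ μ} × ℕ,
      ∀ (μ : {μ // ¬ lam ≤ μ}) i r, φ ((μ : ι →₀ ℕ) + i • lam, r) = (μ, i * q + r) := by
  let div := (Equiv.ofBijective _ ⟨injective_add_nsmul lam, surjective_add_nsmul h⟩).symm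
  refine ⟨(div.prodCongr (Equiv.refl _)).trans ((Equiv.prodAssoc _ _ _).trans
    ((Equiv.refl _).prodCongr (Nat.divModEquiv q).symm)), fun μ i r => ?_⟩
  have hdiv : div ((μ : ι →₀ ℕ) + i • lam) = (μ, i) :=
    (Equiv.ofBijective _ _).symm_apply_apply (μ, i)
  simp [hdiv, Nat.divModEquiv]

end Exponents

section Counting

variable (ι : Type*) [Fintype ι]

open scoped Classical in
/-- The multi-exponents of total degree less than `k`, as a finite set. -/
noncomputable def exponentsBelow (k : ℕ) : Finset (ι →₀ ℕ) :=
  (Finset.range k).biUnion fun i => Finset.univ.finsuppAntidiag i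

variable {ι}

theorem mem_exponentsBelow {k : ℕ} {α : ι →₀ ℕ} : α ∈ exponentsBelow ι k ↔ α.degree < k := by
  simp [exponentsBelow, Finset.mem_finsuppAntidiag, Finsupp.degree_eq_sum]

theorem card_exponentsBelow {t : ℕ} (hι : Fintype.card ι = t + 1) (k : ℕ) :
    (exponentsBelow ι k).card = (k + t).choose (t + 1) := by
  classical
  rw [exponentsBelow, Finset.card_biUnion]
  · simp only [Finset.card_finsuppAntidiag_nat_eq_multichoose, Finset.card_univ, hι]
    cases k with
    | zero => simp
    | succ k => rw [Nat.sum_range_multichoose, Nat.add_right_comm, Nat.add_assoc]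
  · intro i _ j _ hij
    refine Finset.disjoint_left.mpr fun α hi hj => hij ?_
    rw [Finset.mem_finsuppAntidiag] at hi hj
    exact hi.1.symm.trans hj.1

theorem card_le_card_exponentsBelow {K κ : Type*} [CommRing K] [StrongRankCondition K] [Fintype κ]
    {f : κ → MvPolynomial ι K} (hf : LinearIndependent K f) {k : ℕ}
    (hk : ∀ i, f i ∈ lowDegree K ι k) : Fintype.card κ ≤ (exponentsBelow ι k).card := by
  have e : {γ : ι →₀ ℕ | γ.degree < k} ≃ exponentsBelow ι k :=
    Equiv.subtypeEquivRight fun γ => mem_exponentsBelow.symm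
  have hli : LinearIndependent K fun i => (⟨f i, hk i⟩ : lowDegree K ι k) :=
    LinearIndependent.of_comp (lowDegree K ι k).subtype hf
  exact (((basisRestrictSupport K _).reindex e).card_le_card_of_linearIndependent hli).trans_eq
    (Fintype.card_coe _)

theorem le_pow_of_forall_mul_pow_le {a c d s : ℕ} (h : ∀ M, a * M ^ s ≤ (d * M + c) ^ s) :
    a ≤ d ^ s := by
  have hlim : Filter.Tendsto (fun M : ℕ => ((d : ℝ) + c / M) ^ s) Filter.atTop
      (nhds ((d + 0 : ℝ) ^ s)) :=
    (tendsto_const_nhds.add (tendsto_const_div_atTop_nhds_zero_nat _)).pow s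
  rw [add_zero] at hlim
  suffices (a : ℝ) ≤ (d : ℝ) ^ s by exact_mod_cast this
  refine ge_of_tendsto hlim (Filter.eventually_atTop.mpr ⟨1, fun M hM => ?_⟩)
  have : (0 : ℝ) < M := by exact_mod_cast hM
  have hdiv : (d : ℝ) + c / M = (d * M + c) / M := by field_simp
  rw [hdiv, div_pow, le_div_iff₀ (by positivity)]
  exact_mod_cast h M

theorem le_pow_of_forall_mul_card_exponentsBelow_le {t : ℕ} (hι : Fintype.card ι = t + 1)
    {a d e : ℕ}
    (h : ∀ M, a * (exponentsBelow ι M).card ≤ (exponentsBelow ι (d * (M + e))).card) :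
    a ≤ d ^ (t + 1) := by
  refine le_pow_of_forall_mul_pow_le (c := d * e + t) fun M => ?_
  suffices (a : ℝ) * M ^ (t + 1) ≤ ((d * (M + e) + t : ℕ) : ℝ) ^ (t + 1) by
    rw [← add_assoc, ← mul_add]
    exact_mod_cast this
  have hfact : (0 : ℝ) < (t + 1).factorial := by positivity
  have hlower : (M : ℝ) ^ (t + 1) / (t + 1).factorial ≤ (exponentsBelow ι M).card := by
    rw [card_exponentsBelow hι]
    simpa [add_assoc] using Nat.pow_le_choose (α := ℝ) (t + 1) (M + t)
  have hupper : ((exponentsBelow ι (d * (M + e))).card : ℝ) ≤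
      ((d * (M + e) + t : ℕ) : ℝ) ^ (t + 1) / (t + 1).factorial := by
    rw [card_exponentsBelow hι]
    exact Nat.choose_le_pow_div _ _
  rw [← div_le_div_iff_of_pos_right hfact, mul_div_assoc]
  calc (a : ℝ) * (M ^ (t + 1) / (t + 1).factorial)
      ≤ a * (exponentsBelow ι M).card := by gcongr
    _ ≤ (exponentsBelow ι (d * (M + e))).card := by exact_mod_cast h M
    _ ≤ _ := hupper

end Counting

theorem linearIndependent_of_injective_degree {ι κ K : Type*} [CommRing K] [NoZeroDivisors K]
    (m : MonomialOrder ι) {f : κ → MvPolynomial ι K} (hf₀ : ∀ i, f i ≠ 0)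
    (hf : Function.Injective fun i => m.degree (f i)) : LinearIndependent K f := by
  classical
  rw [linearIndependent_iff']
  intro s g hg
  by_contra! hne
  obtain ⟨i₀, hi₀, hgi₀⟩ := hne
  obtain ⟨i, hi, hmax⟩ := Finset.exists_max_image (s.filter fun i => g i ≠ 0)
    (fun i => m.toSyn (m.degree (f i))) ⟨i₀, Finset.mem_filter.mpr ⟨hi₀, hgi₀⟩⟩
  rw [Finset.mem_filter] at hi
  have hcoeff := congrArg (coeff (m.degree (f i))) hg
  rw [coeff_sum, coeff_zero, Finset.sum_eq_single_of_mem i hi.1, coeff_smul, smul_eq_mul] at hcoeff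
  · exact mul_ne_zero hi.2 (m.coeff_degree_ne_zero_iff.mpr (hf₀ i)) hcoeff
  · intro j hj hji
    rw [coeff_smul, smul_eq_mul]
    obtain hgj | hgj := eq_or_ne (g j) 0
    · rw [hgj, zero_mul]
    · have hdeg : m.toSyn (m.degree (f j)) ≠ m.toSyn (m.degree (f i)) := fun heq =>
        hji (hf (m.toSyn.injective heq))
      rw [m.coeff_eq_zero_of_lt ((hmax j (Finset.mem_filter.mpr ⟨hj, hgj⟩)).lt_of_ne hdeg),
        mul_zero]

namespace IsPBWBasis

section Domain

variable {K ι W : Type*} [CommRing K] [IsDomain K] [Ring W] [Algebra K W] {x : ι → W}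
  {b : Module.Basis (ι →₀ ℕ) K W}

theorem fullSymbol_mul_sub_mem_totalDegree_mul (h : IsPBWBasis x b) {u v : W} (hu : u ≠ 0)
    (hv : v ≠ 0) : fullSymbol b (u * v) - fullSymbol b u * fullSymbol b v ∈
      lowDegree K ι (fullSymbol b u * fullSymbol b v).totalDegree := by
  rw [totalDegree_mul_of_isDomain ((fullSymbol b).map_ne_zero_iff.mpr hu)
    ((fullSymbol b).map_ne_zero_iff.mpr hv)]
  exact h.fullSymbol_mul_sub_mem u v

theorem noZeroDivisors (h : IsPBWBasis x b) : NoZeroDivisors W where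
  eq_zero_or_eq_zero_of_mul_eq_zero {u v} huv := by
    by_contra! hne
    have hmem := h.fullSymbol_mul_sub_mem_totalDegree_mul hne.1 hne.2
    rw [huv, map_zero, zero_sub, neg_mem_iff] at hmem
    simpa [hne] using eq_zero_of_mem_lowDegree_totalDegree hmem

section LeadingExponent

variable [LinearOrder ι] [WellFoundedGT ι]

theorem degLex_degree_fullSymbol_mul (h : IsPBWBasis x b) {u v : W} (hu : u ≠ 0) (hv : v ≠ 0) :
    degLex.degree (fullSymbol b (u * v)) =
      degLex.degree (fullSymbol b u) + degLex.degree (fullSymbol b v) := by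
  rw [← degLex.degree_mul ((fullSymbol b).map_ne_zero_iff.mpr hu)
    ((fullSymbol b).map_ne_zero_iff.mpr hv), ← degLex_degree_add_of_mem_lowDegree
    (h.fullSymbol_mul_sub_mem_totalDegree_mul hu hv), add_sub_cancel]

theorem degLex_degree_fullSymbol_pow (h : IsPBWBasis x b) {a : W} (ha : a ≠ 0) (k : ℕ) :
    degLex.degree (fullSymbol b (a ^ k)) = k • degLex.degree (fullSymbol b a) := by
  have := h.noZeroDivisors
  induction k with
  | zero => simp [h.fullSymbol_one]
  | succ k ih =>
    have : Nontrivial W := ⟨a, 0, ha⟩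
    rw [pow_succ, add_smul, one_smul, ← ih, h.degLex_degree_fullSymbol_mul (pow_ne_zero k ha) ha]

theorem linearIndependent_basis_mul_pow (h : IsPBWBasis x b) {a : W} (ha : a ≠ 0) :
    LinearIndependent K fun p : {μ // ¬ degLex.degree (fullSymbol b a) ≤ μ} × ℕ =>
      b p.1 * a ^ p.2 := by
  classical
  have := h.noZeroDivisors
  have : Nontrivial W := ⟨a, 0, ha⟩
  refine LinearIndependent.of_comp (fullSymbol b).toLinearMap
    (linearIndependent_of_injective_degree degLex (fun p => ?_) ?_)
  · exact (fullSymbol b).map_ne_zero_iff.mpr (mul_ne_zero (b.ne_zero _) (pow_ne_zero _ ha))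
  · convert injective_add_nsmul (degLex.degree (fullSymbol b a)) using 2 with p
    change degLex.degree (fullSymbol b (b p.1 * a ^ p.2)) = _
    rw [h.degLex_degree_fullSymbol_mul (b.ne_zero _) (pow_ne_zero _ ha),
      h.degLex_degree_fullSymbol_pow ha, fullSymbol_basis, degree_monomial, if_neg one_ne_zero]

end LeadingExponent

variable [Fintype ι]

theorem mul_card_exponentsBelow_le (h : IsPBWBasis x b) (σ : W ≃ₐ[K] W) {d : ℕ} (hd₀ : 0 < d)
    (hd : ∀ i, (fullSymbol b (σ (x i))).totalDegree ≤ d) {a : W}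
    (ha₀ : 0 < (fullSymbol b a).totalDegree) (ha : (fullSymbol b (σ a)).totalDegree ≤ 1) (M : ℕ) :
    d * (fullSymbol b a).totalDegree * (exponentsBelow ι M).card ≤
      (exponentsBelow ι (d * (M + (fullSymbol b a).totalDegree))).card := by
  let _ : LinearOrder ι := LinearOrder.lift' (Fintype.equivFin ι) (Fintype.equivFin ι).injective
  set e := (fullSymbol b a).totalDegree
  set lam := degLex.degree (fullSymbol b a)
  have ha_ne : a ≠ 0 := by
    rintro rfl
    simp [e] at ha₀
  have hlam : lam.degree = e := degree_degLexDegree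
  have hlam₀ : lam ≠ 0 := by
    intro h₀
    simp [← hlam, h₀] at ha₀
  have : NeZero (d * e) := ⟨(Nat.mul_pos hd₀ ha₀).ne'⟩
  obtain ⟨φ, hφ⟩ := exists_equiv_not_le_prod hlam₀ (d * e)
  let f : exponentsBelow ι M × Fin (d * e) → W := fun p =>
    b (φ (p.1, p.2)).1 * a ^ (φ (p.1, p.2)).2
  have hf : LinearIndependent K fun p => fullSymbol b (σ (f p)) :=
    ((h.linearIndependent_basis_mul_pow ha_ne).comp _
      (φ.injective.comp (Subtype.val_injective.prodMap Function.injective_id))).map'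
      (σ.toLinearEquiv.trans (fullSymbol b)).toLinearMap (LinearEquiv.ker _)
  have hlow : ∀ p, fullSymbol b (σ (f p)) ∈ lowDegree K ι (d * (M + e)) := by
    rintro ⟨⟨ν, hν⟩, r⟩
    obtain ⟨⟨μ, i⟩, rfl⟩ := surjective_add_nsmul hlam₀ ν
    have hνM : (μ : ι →₀ ℕ).degree + i * e < M := by
      simpa [hlam] using mem_exponentsBelow.mp hν
    refine mem_lowDegree_of_totalDegree_lt ?_
    simp only [f, hφ, map_mul, map_pow]
    calc (fullSymbol b (σ (b μ) * σ a ^ (i * (d * e) + r))).totalDegree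
        ≤ d * (μ : ι →₀ ℕ).degree + (i * (d * e) + r) * 1 :=
          (h.totalDegree_fullSymbol_mul_le _ _).trans (add_le_add
            (h.totalDegree_fullSymbol_map_basis_le σ.toAlgHom hd _)
            ((h.totalDegree_fullSymbol_pow_le _ _).trans (Nat.mul_le_mul_left _ ha)))
      _ = d * ((μ : ι →₀ ℕ).degree + i * e) + r := by ring
      _ < d * M + d * e := add_lt_add_of_le_of_lt (Nat.mul_le_mul_left d hνM.le) r.2
      _ = d * (M + e) := (mul_add d M e).symm
  simpa [mul_comm] using card_le_card_exponentsBelow hf hlow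

theorem totalDegree_fullSymbol_symm_gen_le_of_isDomain (h : IsPBWBasis x b) {t : ℕ}
    (hι : Fintype.card ι = t + 1) (σ : W ≃ₐ[K] W) {d : ℕ}
    (hd : ∀ i, (fullSymbol b (σ (x i))).totalDegree ≤ d) (j : ι) :
    (fullSymbol b (σ.symm (x j))).totalDegree ≤ d ^ t := by
  have hd₀ : 0 < d := (h.totalDegree_fullSymbol_map_gen_pos σ j).trans_le (hd j)
  have hσa : (fullSymbol b (σ (σ.symm (x j)))).totalDegree ≤ 1 := by
    rw [σ.apply_symm_apply, h.fullSymbol_gen, totalDegree_X]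
  have hpow := le_pow_of_forall_mul_card_exponentsBelow_le hι
    (h.mul_card_exponentsBelow_le σ hd₀ hd (h.totalDegree_fullSymbol_map_gen_pos σ.symm j) hσa)
  rw [pow_succ'] at hpow
  exact Nat.le_of_mul_le_mul_left hpow hd₀

end Domain

end IsPBWBasis

theorem totalDegree_le_of_forall_isPrime {K ι : Type*} [CommRing K] [IsReduced K]
    {p : MvPolynomial ι K} {d : ℕ}
    (h : ∀ P : Ideal K, P.IsPrime → (map (algebraMap K (K ⧸ P)) p).totalDegree ≤ d) :
    p.totalDegree ≤ d := by
  refine Finset.sup_le fun α hα => ?_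
  have hnil : p.coeff α ∉ nilradical K := by
    rw [nilradical_eq_zero]
    exact mem_support_iff.mp hα
  simp only [nilradical_eq_sInf, Ideal.mem_sInf, not_forall] at hnil
  obtain ⟨P, hP, hαP⟩ := hnil
  refine (le_totalDegree (mem_support_iff.mpr ?_)).trans (h P hP)
  rw [coeff_map]
  exact fun h₀ => hαP (Ideal.Quotient.eq_zero_iff_mem.mp h₀)

theorem IsPBWBasis.totalDegree_fullSymbol_symm_gen_le {K ι W : Type*} [CommRing K] [IsReduced K]
    [Ring W] [Algebra K W] [Fintype ι] {x : ι → W} {b : Module.Basis (ι →₀ ℕ) K W}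
    (h : IsPBWBasis x b) {t : ℕ} (hι : Fintype.card ι = t + 1) (σ : W ≃ₐ[K] W) {d : ℕ}
    (hd : ∀ i, (fullSymbol b (σ (x i))).totalDegree ≤ d) (j : ι) :
    (fullSymbol b (σ.symm (x j))).totalDegree ≤ d ^ t := by
  refine totalDegree_le_of_forall_isPrime fun P hP => ?_
  let σP : (K ⧸ P) ⊗[K] W ≃ₐ[K ⧸ P] (K ⧸ P) ⊗[K] W :=
    Algebra.TensorProduct.congr AlgEquiv.refl σ
  have hσP : ∀ i, (fullSymbol (b.baseChange (K ⧸ P)) (σP (1 ⊗ₜ[K] x i))).totalDegree ≤ d := by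
    intro i
    change (fullSymbol (b.baseChange (K ⧸ P)) (1 ⊗ₜ[K] σ (x i))).totalDegree ≤ d
    rw [fullSymbol_baseChange_one_tmul]
    exact (Finset.sup_mono (support_map_subset _ _)).trans (hd i)
  rw [← fullSymbol_baseChange_one_tmul]
  exact (h.baseChange (K ⧸ P)).totalDegree_fullSymbol_symm_gen_le_of_isDomain hι σP hσP j

section PowWord

variable {k : ℕ} {ι : Type*}

/-- The word `f 0, …, f 0, f 1, …, f 1, …` in which the letter `f i` is repeated `a i` times. -/
def powWord (f : Fin k → ι) (a : Fin k → ℕ) : List ι :=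
  (List.ofFn fun i => List.replicate (a i) (f i)).flatten

theorem coe_powWord (f : Fin k → ι) (a : Fin k → ℕ) :
    (powWord f a : Multiset ι) = ∑ i, a i • {f i} := by
  rw [powWord, ← Multiset.coe_join, Multiset.join, Multiset.sum_coe, List.map_ofFn, List.sum_ofFn]
  refine Finset.sum_congr rfl fun i _ => ?_
  rw [Function.comp_apply, Multiset.coe_replicate, Multiset.nsmul_singleton]

theorem map_prod_ofFn_pow {M N G : Type*} [Monoid M] [Monoid N] [FunLike G M N]
    [MonoidHomClass G M N] (g : G) {y : Fin k → M}
    {x : ι → N} {f : Fin k → ι} (hg : ∀ i, g (y i) = x (f i)) (a : Fin k → ℕ) :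
    g (List.ofFn fun i => y i ^ a i).prod = ((powWord f a).map x).prod := by
  rw [powWord, List.map_flatten, List.prod_flatten, List.map_ofFn, List.map_ofFn, map_list_prod,
    List.map_ofFn]
  simp [Function.comp_def, hg]

end PowWord

theorem WeylAlgebra.exists_commutator_gen_eq_algebraMap {K : Type*} [CommRing K] {n : ℕ}
    (i j : Fin n ⊕ Fin n) :
    ∃ c : K, gen K n i * gen K n j - gen K n j * gen K n i = algebraMap K _ c := by
  rcases i with i | i <;> rcases j with j | j
  · exact ⟨0, by rw [q_comm, sub_self, map_zero]⟩
  · refine ⟨-(if j = i then 1 else 0), ?_⟩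
    rw [p_mul_q]
    split_ifs <;> simp
  · refine ⟨if i = j then 1 else 0, ?_⟩
    rw [p_mul_q]
    split_ifs <;> simp
  · exact ⟨0, by rw [p_comm, sub_self, map_zero]⟩

namespace WeylPoly

variable {K : Type*} [CommRing K] {n m : ℕ}

theorem exists_commutator_gen_eq_algebraMap (i j : (Fin n ⊕ Fin n) ⊕ Fin m) :
    ∃ c : K, gen K n m i * gen K n m j - gen K n m j * gen K n m i = algebraMap K _ c := by
  rcases i with i | i <;> rcases j with j | j
  · obtain ⟨c, hc⟩ := WeylAlgebra.exists_commutator_gen_eq_algebraMap (K := K) i j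
    refine ⟨c, ?_⟩
    simp only [gen, Sum.elim_inl, Algebra.TensorProduct.tmul_mul_tmul, ← TensorProduct.sub_tmul, hc,
      mul_one, Algebra.TensorProduct.algebraMap_apply]
  all_goals exact ⟨0, by simp [gen, mul_comm]⟩

/-- Collects the `q`-, `p`- and polynomial parts of a multi-exponent into a single multi-exponent
on the index set of the generators. -/
noncomputable def expEquiv (n m : ℕ) : ((Fin n →₀ ℕ) × (Fin n →₀ ℕ)) × (Fin m →₀ ℕ) ≃
    ((Fin n ⊕ Fin n) ⊕ Fin m →₀ ℕ) :=
  (Equiv.prodCongr Finsupp.sumFinsuppEquivProdFinsupp.symm (Equiv.refl _)).trans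
    Finsupp.sumFinsuppEquivProdFinsupp.symm

theorem degree_expEquiv (α : ((Fin n →₀ ℕ) × (Fin n →₀ ℕ)) × (Fin m →₀ ℕ)) :
    (expEquiv n m α).degree = expDegree α := by
  simp [expEquiv, expDegree, Finsupp.degree_eq_sum, Fintype.sum_sum_type]

/-- The basis of ordered monomials, indexed by multi-exponents on the set of generators. -/
noncomputable def pbwBasis (K : Type*) [CommRing K] (n m : ℕ) :
    Module.Basis ((Fin n ⊕ Fin n) ⊕ Fin m →₀ ℕ) K (WeylPoly K n m) :=
  (basis K n m).reindex (expEquiv n m)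

theorem pbwBasis_expEquiv (α : ((Fin n →₀ ℕ) × (Fin n →₀ ℕ)) × (Fin m →₀ ℕ)) :
    pbwBasis K n m (expEquiv n m α) = WeylAlgebra.mono K n α.1 ⊗ₜ[K] monomial α.2 1 := by
  obtain ⟨e, c⟩ := α
  simp [pbwBasis, basis, WeylAlgebra.basis, Module.Basis.tensorProduct_apply]

theorem isPBWBasis_pbwBasis : IsPBWBasis (gen K n m) (pbwBasis K n m) where
  commutator_mem i j := by
    obtain ⟨c, hc⟩ := exists_commutator_gen_eq_algebraMap (K := K) i j
    exact hc ▸ algebraMap_mem_wordSpan c two_pos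
  exists_word α := by
    obtain ⟨⟨⟨a, a'⟩, c⟩, rfl⟩ := (expEquiv n m).surjective α
    let ofWeyl : WeylAlgebra K n →ₐ[K] WeylPoly K n m := Algebra.TensorProduct.includeLeft
    let ofPoly : MvPolynomial (Fin m) K →ₐ[K] WeylPoly K n m := Algebra.TensorProduct.includeRight
    refine ⟨powWord (fun i => Sum.inl (Sum.inl i)) a ++ powWord (fun i => Sum.inl (Sum.inr i)) a' ++
      powWord Sum.inr c, ?_, ?_⟩
    · rw [← Multiset.coe_add, ← Multiset.coe_add, coe_powWord, coe_powWord, coe_powWord,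
        Finsupp.toMultiset_apply, Finsupp.sum_fintype _ _ (by simp), Fintype.sum_sum_type,
        Fintype.sum_sum_type]
      simp [expEquiv]
    · have hsplit : pbwBasis K n m (expEquiv n m ((a, a'), c)) =
          ofWeyl (WeylAlgebra.mono K n (a, a')) * ofPoly (monomial c 1) := by
        simp [pbwBasis_expEquiv, ofWeyl, ofPoly]
      have hq (i) : ofWeyl (WeylAlgebra.q K i) = gen K n m (Sum.inl (Sum.inl i)) := rfl
      have hp (i) : ofWeyl (WeylAlgebra.p K i) = gen K n m (Sum.inl (Sum.inr i)) := rfl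
      have hX (i) : ofPoly (X i) = gen K n m (Sum.inr i) := rfl
      rw [hsplit, WeylAlgebra.mono, map_mul, WeylAlgebra.monomial_eq_prod_ofFn,
        map_prod_ofFn_pow ofWeyl hq, map_prod_ofFn_pow ofWeyl hp, map_prod_ofFn_pow ofPoly hX,
        List.map_append, List.map_append, List.prod_append, List.prod_append]

theorem degree_eq_totalDegree_fullSymbol (a : WeylPoly K n m) :
    degree a = (fullSymbol (pbwBasis K n m) a).totalDegree := by
  refine eq_of_forall_ge_iff fun d => ?_
  change _ ≤ d ↔ (fullSymbol (pbwBasis K n m) a).support.sup Finsupp.degree ≤ d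
  rw [degree, Finset.sup_le_iff, Finset.sup_le_iff, (expEquiv n m).surjective.forall]
  simp [degree_expEquiv, coeff_fullSymbol, pbwBasis]

end WeylPoly

open WeylPoly in
theorem corollary3p4_general {K : Type*} [CommRing K] [IsReduced K] (n m : ℕ)
    (hs : 1 ≤ 2 * n + m) (σ : WeylPoly K n m ≃ₐ[K] WeylPoly K n m) :
    autDegree σ.symm ≤ autDegree σ ^ (2 * n + m - 1) := by
  have hcard : Fintype.card ((Fin n ⊕ Fin n) ⊕ Fin m) = 2 * n + m - 1 + 1 := by
    rw [Nat.sub_add_cancel hs]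
    simp [two_mul]
  have hσ (i) : (fullSymbol (pbwBasis K n m) (σ (gen K n m i))).totalDegree ≤ autDegree σ := by
    rw [← degree_eq_totalDegree_fullSymbol]
    exact Finset.le_sup (f := fun i => degree (σ (gen K n m i))) (Finset.mem_univ i)
  refine Finset.sup_le fun j _ => ?_
  rw [degree_eq_totalDegree_fullSymbol]
  exact isPBWBasis_pbwBasis.totalDegree_fullSymbol_symm_gen_le hcard σ hσ j

theorem corollary3p4 {K : Type*} [CommRing K] [Algebra ℚ K] [IsReduced K] (n m : ℕ)
    (hs : 1 ≤ 2 * n + m) (σ : WeylPoly K n m ≃ₐ[K] WeylPoly K n m) :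
    WeylPoly.autDegree σ.symm ≤ WeylPoly.autDegree σ ^ (2 * n + m - 1) :=
  corollary3p4_general n m hs σ
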